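/- Let $X$ be a compact (Hausdorff, boundaryless) smooth manifold of dimension $m$, let $Y \subset \mathbb{R}^q$ be a subset with the subspace topology (for instance a smooth submanifold of $\mathbb{R}^q$), and let $f \colon X \to Y$ be continuous. Let $g \colon \mathbb{R}^p \to \mathbb{R}^q$ be a surjective linear map (so that $p \ge q$), let $\|\cdot\|$ be any norm on $\mathbb{R}^q$, and suppose that $p > 2m$. Then for every $\varepsilon > 0$ there is a smooth ($C^\infty$) embedding $\tilde h \colon X \to \mathbb{R}^p$, that is, a $C^\infty$ immersion that is a homeomorphism onto its image, such that $\| f(x) - g(\tilde h(x)) \| < \varepsilon$ for all $x \in X$. -/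

import Mathlib

open scoped Manifold ContDiff

open Set Module Topology

/-! ### Hausdorff dimension of the set of bad linear perturbations. -/

section Perturbation

variable {Z V P : Type*} [NormedAddCommGroup Z] [NormedSpace ℝ Z] [FiniteDimensional ℝ Z]
  [NormedAddCommGroup V] [NormedSpace ℝ V] [FiniteDimensional ℝ V]
  [NormedAddCommGroup P] [NormedSpace ℝ P]

/-! A linear section `s` of `g` reduces the claim to approximating `s ∘ f` by embeddings into ℝ^p.
Take a smooth approximation `k`, an embedding `e` of `X` into some large ℝ^n, and set `h = k + A ∘
e` with `A` linear and small. Then `h` fails to be an injective immersion only if `A` sends a secant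
`e x - e y ≠ 0` to `k y - k x`, or a tangent vector `de v ≠ 0` to `-dk v`. Each such equation
imposes `p` conditions on `A` and the family has `2m < p` parameters, so the bad `A` have less than
full Hausdorff dimension and arbitrarily small good ones exist (`exists_norm_lt_forall_apply_ne`).
By compactness an injective immersion is an embedding. -/

/-- A `C^1` map on an open set has image of Hausdorff dimension at most that of the source. -/
theorem dimH_image_le_finrank_of_isOpen {f : Z → P} {U : Set Z} (hU : IsOpen U)
    (hf : ContDiffOn ℝ 1 f U) : dimH (f '' U) ≤ finrank ℝ Z := by
  rw [← Real.dimH_univ_eq_finrank]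
  refine (dimH_image_le_of_locally_lipschitzOn fun x hx ↦ ?_).trans (dimH_mono (subset_univ U))
  obtain ⟨C, t, ht, h⟩ := (hf.contDiffAt (hU.mem_nhds hx)).exists_lipschitzOnWith
  exact ⟨C, t, mem_nhdsWithin_of_mem_nhds ht, h⟩

variable [FiniteDimensional ℝ P]

theorem finrank_ker_apply_add_finrank {v : V} (hv : v ≠ 0) :
    finrank ℝ (ContinuousLinearMap.apply ℝ P v).ker + finrank ℝ P = finrank ℝ (V →L[ℝ] P) := by
  have hs : Function.Surjective (ContinuousLinearMap.apply ℝ P v : (V →L[ℝ] P) →L[ℝ] P) := by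
    intro y
    obtain ⟨φ, hφ⟩ := SeparatingDual.exists_eq_one (R := ℝ) hv
    exact ⟨φ.smulRight y, by simp [hφ]⟩
  have h := (ContinuousLinearMap.apply ℝ P v :
    (V →L[ℝ] P) →L[ℝ] P).toLinearMap.finrank_range_add_finrank_ker
  rw [LinearMap.range_eq_top.2 hs, finrank_top] at h
  rw [← h, add_comm]

/-- The linear maps that send some `w z ≠ 0` to `u z` form a set of codimension at least
`dim P - dim Z`. -/
theorem dimH_setOf_exists_apply_eq_le {U : Set Z} (hU : IsOpen U) {w : Z → V} {u : Z → P}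
    (hw : ContDiffOn ℝ 1 w U) (hu : ContDiffOn ℝ 1 u U) :
    dimH {A : V →L[ℝ] P | ∃ z ∈ U, w z ≠ 0 ∧ A (w z) = u z} ≤
      ((finrank ℝ Z + (finrank ℝ (V →L[ℝ] P) - finrank ℝ P) : ℕ) : ENNReal) := by
  let b := finBasis ℝ V
  let l : Fin (finrank ℝ V) → V →L[ℝ] ℝ := fun i ↦ (b.coord i).toContinuousLinearMap
  let K : Fin (finrank ℝ V) → Submodule ℝ (V →L[ℝ] P) :=
    fun i ↦ (ContinuousLinearMap.apply ℝ P (b i)).ker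
  -- Write `A = B + l i ⊗ y` with `B` killing `b i`. Where `l i (w z) ≠ 0`, the equation `A (w z) =
  -- u z` determines `y`, so `(z, B)` parametrizes the solutions.
  let Φ : ∀ i, Z × K i → V →L[ℝ] P := fun i y ↦
    (y.2 : V →L[ℝ] P) +
      (l i).smulRight ((l i (w y.1))⁻¹ • (u y.1 - (y.2 : V →L[ℝ] P) (w y.1)))
  let W : ∀ i, Set (Z × K i) := fun i ↦ (U ∩ (fun z ↦ l i (w z)) ⁻¹' {0}ᶜ) ×ˢ univ
  have hWo : ∀ i, IsOpen (W i) := fun i ↦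
    (((l i).continuous.comp_continuousOn hw.continuousOn).isOpen_inter_preimage hU
      isOpen_compl_singleton).prod isOpen_univ
  have hΦ : ∀ i, ContDiffOn ℝ 1 (Φ i) (W i) := by
    intro i
    let S : Z × K i →L[ℝ] (V →L[ℝ] P) := (K i).subtypeL.comp (ContinuousLinearMap.snd ℝ Z (K i))
    have h2 : ContDiff ℝ 1 (fun y : Z × K i ↦ (y.2 : V →L[ℝ] P)) :=
      ContinuousLinearMap.contDiff (𝕜 := ℝ) (n := 1) (E := Z × K i) (F := V →L[ℝ] P) S
    have hm : MapsTo Prod.fst (W i) U := fun y hy ↦ hy.1.1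
    have hw' : ContDiffOn ℝ 1 (fun y : Z × K i ↦ w y.1) (W i) := hw.comp contDiffOn_fst hm
    have hu' : ContDiffOn ℝ 1 (fun y : Z × K i ↦ u y.1) (W i) := hu.comp contDiffOn_fst hm
    have h3 : ContDiffOn ℝ 1 (fun y : Z × K i ↦
        (l i (w y.1))⁻¹ • (u y.1 - (y.2 : V →L[ℝ] P) (w y.1))) (W i) :=
      (((l i).contDiff.comp_contDiffOn hw').inv fun y hy ↦ hy.1.2).smul
        (hu'.sub (h2.contDiffOn.clm_apply hw'))
    exact h2.contDiffOn.add
      ((ContinuousLinearMap.smulRightL ℝ V P (l i)).contDiff.comp_contDiffOn h3)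
  have hsub : {A : V →L[ℝ] P | ∃ z ∈ U, w z ≠ 0 ∧ A (w z) = u z} ⊆ ⋃ i, Φ i '' W i := by
    rintro A ⟨z, hz, hwz, hA⟩
    obtain ⟨i, hi⟩ : ∃ i, l i (w z) ≠ 0 := by
      by_contra! h
      exact hwz (b.ext_elem fun i ↦ by simpa [l] using h i)
    have hl : l i (b i) = 1 := by simp [l]
    refine mem_iUnion.2 ⟨i, (z, ⟨A - (l i).smulRight (A (b i)), ?_⟩), ⟨⟨hz, hi⟩, trivial⟩, ?_⟩
    · simp [K, hl]
    · ext v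
      simp [Φ, hA, smul_smul, inv_mul_cancel₀ hi]
  refine (dimH_mono hsub).trans ?_
  rw [dimH_iUnion]
  refine iSup_le fun i ↦ (dimH_image_le_finrank_of_isOpen (hWo i) (hΦ i)).trans ?_
  have := finrank_ker_apply_add_finrank (P := P) (b.ne_zero i)
  rw [finrank_prod]
  exact_mod_cast (by simp only [K]; omega)

/-- Arbitrarily small linear maps avoid countably many conditions `A (w z) = u z` that depend on
fewer than `dim P` parameters. -/
theorem exists_norm_lt_forall_apply_ne {ι : Type*} [Countable ι] (hZP : finrank ℝ Z < finrank ℝ P)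
    {U : ι → Set Z} (hU : ∀ i, IsOpen (U i)) {w : ι → Z → V} {u : ι → Z → P}
    (hw : ∀ i, ContDiffOn ℝ 1 (w i) (U i)) (hu : ∀ i, ContDiffOn ℝ 1 (u i) (U i))
    {δ : ℝ} (hδ : 0 < δ) :
    ∃ A : V →L[ℝ] P, ‖A‖ < δ ∧ ∀ i, ∀ z ∈ U i, w i z ≠ 0 → A (w i z) ≠ u i z := by
  -- For `V ≠ 0` the natural-number subtraction in the dimension bound is not truncated.
  rcases subsingleton_or_nontrivial V with hV | hV
  · exact ⟨0, by simpa, fun i z _ h ↦ (h (Subsingleton.elim _ _)).elim⟩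
  have hd : dimH (⋃ i, {A : V →L[ℝ] P | ∃ z ∈ U i, w i z ≠ 0 ∧ A (w i z) = u i z}) <
      finrank ℝ (V →L[ℝ] P) := by
    rw [dimH_iUnion]
    refine (iSup_le fun i ↦ dimH_setOf_exists_apply_eq_le (hU i) (hw i) (hu i)).trans_lt ?_
    obtain ⟨v, hv⟩ := exists_ne (0 : V)
    have := finrank_ker_apply_add_finrank (P := P) hv
    exact_mod_cast (by omega)
  obtain ⟨A, hA, hAδ⟩ := (dense_compl_of_dimH_lt_finrank hd).exists_dist_lt 0 hδ
  refine ⟨A, by simpa using hAδ, fun i z hz hne heq ↦ hA (mem_iUnion.2 ⟨i, z, hz, hne, heq⟩)⟩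

end Perturbation

/-! ### From injective derivatives to local normal forms. -/

section Immersion

theorem exists_openPartialHomeomorph_contDiffOn_symm {E F : Type*}
    [NormedAddCommGroup E] [NormedSpace ℝ E] [CompleteSpace E]
    [NormedAddCommGroup F] [NormedSpace ℝ F] {f : E → F} {U : Set E}
    (hU : IsOpen U) (hf : ContDiffOn ℝ ∞ f U) {a : E} (ha : a ∈ U) {f' : E ≃L[ℝ] F}
    (hf' : HasFDerivAt f (f' : E →L[ℝ] F) a) :
    ∃ Ψ : OpenPartialHomeomorph E F, ⇑Ψ = f ∧ a ∈ Ψ.source ∧ Ψ.source ⊆ U ∧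
      ContDiffOn ℝ ∞ Ψ.symm Ψ.target := by
  have hn : (∞ : WithTop ℕ∞) ≠ 0 := by simp
  let Ψ₀ := (hf.contDiffAt (hU.mem_nhds ha)).toOpenPartialHomeomorph f hf' hn
  -- Invertibility of the derivative is an open condition; on `S` the inverse is smooth at every
  -- point, not only at the image of `a`.
  let S : Set E := U ∩ fderiv ℝ f ⁻¹' range ((↑) : (E ≃L[ℝ] F) → E →L[ℝ] F)
  have hS : IsOpen S :=
    (hf.continuousOn_fderiv_of_isOpen hU (by simp)).isOpen_inter_preimage hU
      ContinuousLinearEquiv.isOpen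
  have hsrc : (Ψ₀.restr S).source = Ψ₀.source ∩ S := Ψ₀.restr_source' S hS
  refine ⟨Ψ₀.restr S, rfl, ?_, ?_, ?_⟩
  · rw [hsrc]
    exact ⟨ContDiffAt.mem_toOpenPartialHomeomorph_source _ hf' hn, ha, f', hf'.fderiv.symm⟩
  · rw [hsrc]
    exact fun x hx ↦ hx.2.1
  · intro y hy
    have hx := (Ψ₀.restr S).map_target hy
    rw [hsrc] at hx
    obtain ⟨-, hxU, g', hg'⟩ := hx
    have hfx := hf.contDiffAt (hU.mem_nhds hxU)
    refine ((Ψ₀.restr S).contDiffAt_symm (f₀' := g') hy ?_ hfx).contDiffWithinAt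
    rw [hg']
    exact (hfx.differentiableAt hn).hasFDerivAt

theorem exists_continuousLinearEquiv_prod_extending {E F P : Type*}
    [NormedAddCommGroup E] [NormedSpace ℝ E] [FiniteDimensional ℝ E]
    [NormedAddCommGroup F] [NormedSpace ℝ F] [FiniteDimensional ℝ F]
    [NormedAddCommGroup P] [NormedSpace ℝ P] [FiniteDimensional ℝ P]
    (hEF : finrank ℝ E + finrank ℝ F = finrank ℝ P)
    (D : E →L[ℝ] P) (hD : Function.Injective D) :
    ∃ L : (E × F) ≃L[ℝ] P, ∀ v, L (v, 0) = D v := by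
  obtain ⟨C, hC⟩ := Submodule.exists_isCompl D.range
  have hr : finrank ℝ D.range = finrank ℝ E := LinearMap.finrank_range_of_inj hD
  have hfC : finrank ℝ F = finrank ℝ C := by
    have := Submodule.finrank_add_eq_of_isCompl hC
    omega
  let eF : F ≃ₗ[ℝ] C := LinearEquiv.ofFinrankEq _ _ hfC
  let L := ((LinearEquiv.ofInjective D.toLinearMap hD).prodCongr eF).trans
    (Submodule.prodEquivOfIsCompl _ _ hC)
  refine ⟨L.toContinuousLinearEquiv, fun v ↦ ?_⟩
  simp [L]

/-- A map that is smooth with injective derivative in a chart is an immersion. -/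
theorem isImmersionAtOfComplement_of_injective_fderiv {m p : ℕ} (hmp : m ≤ p)
    {X : Type*} [TopologicalSpace X] [ChartedSpace (EuclideanSpace ℝ (Fin m)) X]
    [IsManifold (𝓡 m) ∞ X] {h : X → EuclideanSpace ℝ (Fin p)} {x : X}
    (φ : OpenPartialHomeomorph X (EuclideanSpace ℝ (Fin m)))
    (hφ : φ ∈ IsManifold.maximalAtlas (𝓡 m) ∞ X) (hx : x ∈ φ.source)
    (hh : ContDiffOn ℝ ∞ (h ∘ φ.symm) φ.target)
    (hinj : Function.Injective (fderiv ℝ (h ∘ φ.symm) (φ x))) :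
    Manifold.IsImmersionAtOfComplement (EuclideanSpace ℝ (Fin (p - m))) (𝓡 m) (𝓡 p) ∞ h x := by
  obtain ⟨L, hL⟩ := exists_continuousLinearEquiv_prod_extending
    (F := EuclideanSpace ℝ (Fin (p - m))) (by simp; omega) _ hinj
  have hc : ContinuousAt h x := by
    have h1 : ContinuousAt ((h ∘ φ.symm) ∘ φ) x := ContinuousAt.comp
      (hh.continuousOn.continuousAt (φ.open_target.mem_nhds (φ.map_source hx)))
      (φ.continuousAt hx)
    refine h1.congr ?_
    filter_upwards [φ.open_source.mem_nhds hx] with y hy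
    simp [φ.left_inv hy]
  -- Thickening `h` by a complement of the image of its derivative gives a local diffeomorphism; in
  -- the chart `L ∘ G⁻¹` of the target, `h` becomes `v ↦ L (v, 0)`.
  let G : EuclideanSpace ℝ (Fin m) × EuclideanSpace ℝ (Fin (p - m)) → EuclideanSpace ℝ (Fin p) :=
    fun y ↦ (h ∘ φ.symm) y.1 + L (0, y.2)
  have hLs : ContDiff ℝ ∞ fun y : EuclideanSpace ℝ (Fin m) × EuclideanSpace ℝ (Fin (p - m)) ↦
      L (0, y.2) := L.contDiff.comp (contDiff_const.prodMk contDiff_snd)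
  have hG : ContDiffOn ℝ ∞ G (φ.target ×ˢ univ) :=
    (hh.comp contDiffOn_fst fun y hy ↦ hy.1).add hLs.contDiffOn
  have hd : HasFDerivAt G (L : _ →L[ℝ] EuclideanSpace ℝ (Fin p)) (φ x, 0) := by
    have h1 := ((hh.contDiffAt (φ.open_target.mem_nhds (φ.map_source hx))).differentiableAt
      (by simp)).hasFDerivAt
    have h2 : HasFDerivAt (fun y : EuclideanSpace ℝ (Fin m) × EuclideanSpace ℝ (Fin (p - m)) ↦
        (h ∘ φ.symm) y.1) 
        ((fderiv ℝ (h ∘ φ.symm) (φ x)).comp (ContinuousLinearMap.fst ℝ _ _)) (φ x, 0) :=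
      HasFDerivAt.comp (g := h ∘ φ.symm) (φ x, 0) h1 hasFDerivAt_fst
    let L2 := (L : _ →L[ℝ] EuclideanSpace ℝ (Fin p)).comp
      ((ContinuousLinearMap.inr ℝ (EuclideanSpace ℝ (Fin m)) (EuclideanSpace ℝ (Fin (p - m)))).comp
        (ContinuousLinearMap.snd ℝ (EuclideanSpace ℝ (Fin m)) (EuclideanSpace ℝ (Fin (p - m)))))
    have h3 : HasFDerivAt (fun y : EuclideanSpace ℝ (Fin m) × EuclideanSpace ℝ (Fin (p - m)) ↦
        L (0, y.2)) (L2 : _ →L[ℝ] EuclideanSpace ℝ (Fin p)) (φ x, 0) := L2.hasFDerivAt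
    refine (h2.add h3).congr_fderiv (ContinuousLinearMap.ext fun ⟨a, b⟩ ↦ ?_)
    have : L (a, b) = L (a, 0) + L (0, b) := by rw [← map_add]; simp
    simpa [hL, L2] using this.symm
  obtain ⟨Ψ, hΨ, hmem, hsub, hsymm⟩ := exists_openPartialHomeomorph_contDiffOn_symm
    (φ.open_target.prod isOpen_univ) hG ⟨φ.map_source hx, trivial⟩ hd
  let ψ := Ψ.symm.trans L.toHomeomorph.toOpenPartialHomeomorph
  let S : Set X := φ.source ∩ φ ⁻¹' ((fun v ↦ (v, (0 : EuclideanSpace ℝ (Fin (p - m))))) ⁻¹' Ψ.source)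
  have hS : IsOpen S := φ.isOpen_inter_preimage (Ψ.open_source.preimage (by fun_prop))
  have hG0 : ∀ v, Ψ (v, 0) = h (φ.symm v) := fun v ↦ by simp [hΨ, G]
  have hψ : ψ ∈ contDiffGroupoid ∞ (𝓡 p) := by
    rw [contDiffGroupoid, mem_groupoid_of_pregroupoid]
    have hsrc : ψ.source = Ψ.target := by simp [ψ]
    have htgt : ψ.target = L.symm ⁻¹' Ψ.source := by simp [ψ]
    simp only [contDiffPregroupoid, modelWithCornersSelf_coe, modelWithCornersSelf_coe_symm,
      Function.comp_id, Function.id_comp, preimage_id, range_id, inter_univ, hsrc, htgt]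
    refine ⟨L.contDiff.comp_contDiffOn hsymm, ?_⟩
    have : ContDiffOn ℝ ∞ Ψ Ψ.source := by rw [hΨ]; exact hG.mono hsub
    exact this.comp L.symm.contDiff.contDiffOn fun y hy ↦ hy
  have hxS : x ∈ S := ⟨hx, hmem⟩
  refine .mk_of_continuousAt hc L (φ.restr S) ψ ?_ ?_ ?_
    (StructureGroupoid.mem_maximalAtlas_of_mem_groupoid _ hψ) ?_
  · rw [φ.restr_source' S hS]; exact ⟨hx, hxS⟩
  · have := Ψ.map_source hmem
    rw [hG0, φ.left_inv hx] at this
    simpa [ψ] using this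
  · exact restr_mem_maximalAtlas _ hφ hS
  · intro v hv
    simp only [mfld_simps] at hv
    have hvS := interior_subset hv.2
    have hvΨ : (v, (0 : EuclideanSpace ℝ (Fin (p - m)))) ∈ Ψ.source := by
      simpa [φ.right_inv hv.1] using hvS.2
    have : Ψ.symm (h (φ.symm v)) = (v, 0) := by rw [← hG0, Ψ.left_inv hvΨ]
    simp [ψ, this]

end Immersion

/-! ### Perturbing a smooth approximation to an embedding. -/

section Embedding

variable {m : ℕ} {X : Type*} [TopologicalSpace X] [ChartedSpace (EuclideanSpace ℝ (Fin m)) X]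
  [IsManifold (𝓡 m) ∞ X]

theorem ContMDiff.contDiffOn_comp_chartAt_symm {F : Type*} [NormedAddCommGroup F]
    [NormedSpace ℝ F] {k : X → F} (hk : ContMDiff (𝓡 m) 𝓘(ℝ, F) ∞ k) (c : X) :
    ContDiffOn ℝ ∞ (k ∘ (chartAt (EuclideanSpace ℝ (Fin m)) c).symm)
      (chartAt (EuclideanSpace ℝ (Fin m)) c).target :=
  contMDiffOn_iff_contDiffOn.1 (hk.comp_contMDiffOn contMDiffOn_chart_symm)

theorem injective_fderiv_comp_chartAt_symm {F : Type*} [NormedAddCommGroup F]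
    [NormedSpace ℝ F] {k : X → F} (hk : ContMDiff (𝓡 m) 𝓘(ℝ, F) ∞ k) {c x : X}
    (hx : x ∈ (chartAt (EuclideanSpace ℝ (Fin m)) c).source)
    (hinj : Function.Injective (mfderiv (𝓡 m) 𝓘(ℝ, F) k x)) :
    Function.Injective (fderiv ℝ (k ∘ (chartAt (EuclideanSpace ℝ (Fin m)) c).symm)
      (chartAt (EuclideanSpace ℝ (Fin m)) c x)) := by
  set φ := chartAt (EuclideanSpace ℝ (Fin m)) c
  have hφ : φ.MDifferentiable (𝓡 m) (𝓡 m) := mdifferentiable_chart c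
  have hφx := φ.map_source hx
  rw [← mfderiv_eq_fderiv, mfderiv_comp (I' := 𝓡 m) _
    (hk.mdifferentiable (by simp) _) (hφ.symm.mdifferentiableAt hφx)]
  rw [φ.left_inv hx]
  exact hinj.comp (hφ.symm.mfderiv_injective hφx)

/-- **Whitney**: a continuous map of a compact `m`-manifold into `ℝ^p` with `2 * m < p` is
uniformly approximated by smooth embeddings. -/
theorem exists_isSmoothEmbedding_dist_lt_of_continuous [T2Space X] [CompactSpace X] {p : ℕ}
    (hp : 2 * m < p) {f : X → EuclideanSpace ℝ (Fin p)} (hf : Continuous f) {ε : ℝ} (hε : 0 < ε) :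
    ∃ h : X → EuclideanSpace ℝ (Fin p), Manifold.IsSmoothEmbedding (𝓡 m) (𝓡 p) ∞ h ∧
      ∀ x, dist (h x) (f x) < ε := by
  obtain ⟨n, e, he, hemb, hinj⟩ := exists_embedding_euclidean_of_compact (I := 𝓡 m) (M := X)
  obtain ⟨k, hkf, -⟩ := hf.exists_contMDiff_approx (𝓡 m) ⊤ (continuous_const (y := ε / 2))
    fun _ ↦ half_pos hε
  have hk : ContMDiff (𝓡 m) (𝓡 p) ∞ k := k.contMDiff
  obtain ⟨C, hC⟩ := (isCompact_range he.continuous).isBounded.exists_norm_le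
  replace hC : ∀ x, ‖e x‖ ≤ C := fun x ↦ hC _ (mem_range_self x)
  let c : X → OpenPartialHomeomorph X (EuclideanSpace ℝ (Fin m)) := chartAt _
  obtain ⟨t, -, ht⟩ := isCompact_univ.elim_nhds_subcover (fun x : X ↦ (c x).source)
    fun x _ ↦ chart_source_mem_nhds _ x
  have hcov : ∀ x : X, ∃ i : t, x ∈ (c i).source := fun x ↦ by
    simpa using ht (mem_univ x)
  have hes := fun i : t ↦ he.contDiffOn_comp_chartAt_symm (i : X)
  have hks := fun i : t ↦ hk.contDiffOn_comp_chartAt_symm (i : X)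
  have hde := fun i : t ↦ (hes i).fderiv_of_isOpen (m := 1) (c i).open_target (by norm_cast)
  have hdk := fun i : t ↦ (hks i).fderiv_of_isOpen (m := 1) (c i).open_target (by norm_cast)
  let Z := EuclideanSpace ℝ (Fin m) × EuclideanSpace ℝ (Fin m)
  have hfst : ∀ (i : t) (s : Set (EuclideanSpace ℝ (Fin m))),
    MapsTo Prod.fst ((c i).target ×ˢ s) (c i).target := fun i s z hz ↦ hz.1
  have hsnd : ∀ (i : t) (s : Set (EuclideanSpace ℝ (Fin m))),
    MapsTo Prod.snd (s ×ˢ (c i).target) (c i).target := fun i s z hz ↦ hz.2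
  -- Pairs of charts (`inl`) encode injectivity, single charts with a tangent vector (`inr`) the
  -- immersion condition.
  obtain ⟨A, hAδ, hA⟩ := exists_norm_lt_forall_apply_ne (Z := Z) (ι := (t × t) ⊕ t)
    (V := EuclideanSpace ℝ (Fin n)) (P := EuclideanSpace ℝ (Fin p))
    (by simp only [Z, finrank_prod, finrank_euclideanSpace_fin]; omega)
    (U := Sum.elim (fun ij ↦ (c ij.1).target ×ˢ (c ij.2).target) fun i ↦ (c i).target ×ˢ univ)
    (by
      rintro (⟨i, j⟩ | i)
      · exact (c i).open_target.prod (c j).open_target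
      · exact (c i).open_target.prod isOpen_univ)
    (w := Sum.elim (fun ij z ↦ (e ∘ (c ij.1).symm) z.1 - (e ∘ (c ij.2).symm) z.2)
      fun i z ↦ fderiv ℝ (e ∘ (c i).symm) z.1 z.2)
    (u := Sum.elim (fun ij z ↦ (k ∘ (c ij.2).symm) z.2 - (k ∘ (c ij.1).symm) z.1)
      fun i z ↦ -fderiv ℝ (k ∘ (c i).symm) z.1 z.2)
    (by
      rintro (⟨i, j⟩ | i)
      · exact (((hes i).of_le (by norm_cast)).comp contDiffOn_fst (hfst i _)).sub
          (((hes j).of_le (by norm_cast)).comp contDiffOn_snd (hsnd j _))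
      · exact ((hde i).comp contDiffOn_fst (hfst i _)).clm_apply contDiffOn_snd)
    (by
      rintro (⟨i, j⟩ | i)
      · exact (((hks j).of_le (by norm_cast)).comp contDiffOn_snd (hsnd j _)).sub
          (((hks i).of_le (by norm_cast)).comp contDiffOn_fst (hfst i _))
      · exact (((hdk i).comp contDiffOn_fst (hfst i _)).clm_apply contDiffOn_snd).neg)
    -- The bound `C` may be zero, or negative when `X` is empty, hence `|C| + 1`.
    (show 0 < ε / 2 / (|C| + 1) by positivity)
  have hh : ContMDiff (𝓡 m) (𝓡 p) ∞ fun x ↦ k x + A (e x) :=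
    hk.add (A.contMDiff.comp he)
  refine ⟨fun x ↦ k x + A (e x), ⟨?_, ?_⟩, fun x ↦ ?_⟩
  · refine Manifold.IsImmersionOfComplement.isImmersion
      (F := EuclideanSpace ℝ (Fin (p - m))) fun x ↦ ?_
    obtain ⟨i, hi⟩ := hcov x
    have hmem := (c i).map_source hi
    refine isImmersionAtOfComplement_of_injective_fderiv (by omega) (c i)
      (IsManifold.chart_mem_maximalAtlas _) hi (hh.contDiffOn_comp_chartAt_symm _) ?_
    have hek := injective_fderiv_comp_chartAt_symm he hi (hinj x)
    have hd : fderiv ℝ ((fun x ↦ k x + A (e x)) ∘ (c i).symm) (c i x) =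
        fderiv ℝ (k ∘ (c i).symm) (c i x) + A.comp (fderiv ℝ (e ∘ (c i).symm) (c i x)) := by
      have h1 := (((hks i).contDiffAt ((c i).open_target.mem_nhds hmem)).differentiableAt
        (by simp)).hasFDerivAt
      have h2 := (((hes i).contDiffAt ((c i).open_target.mem_nhds hmem)).differentiableAt
        (by simp)).hasFDerivAt
      exact (h1.add (A.hasFDerivAt.comp _ h2)).fderiv
    rw [hd]
    refine (injective_iff_map_eq_zero _).2 fun v hv ↦ ?_
    by_contra hv0
    refine hA (.inr i) (c i x, v) ⟨hmem, trivial⟩ (fun h0 ↦ hv0 ?_) ?_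
    · exact (injective_iff_map_eq_zero _).1 hek v h0
    · exact eq_neg_of_add_eq_zero_right hv
  · refine (hh.continuous.isClosedEmbedding fun x y hxy ↦ ?_).isEmbedding
    by_contra hne
    obtain ⟨i, hi⟩ := hcov x
    obtain ⟨j, hj⟩ := hcov y
    refine hA (.inl (i, j)) (c i x, c j y) ⟨(c i).map_source hi, (c j).map_source hj⟩ ?_ ?_
    · simpa [(c i).left_inv hi, (c j).left_inv hj, sub_eq_zero] using hemb.injective.ne hne
    · simp only [Sum.elim_inl, Function.comp_apply, (c i).left_inv hi, (c j).left_inv hj, map_sub]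
      have : k x + A (e x) = k y + A (e y) := hxy
      rw [sub_eq_sub_iff_add_eq_add, add_comm, this, add_comm]
  · have hb : ‖A (e x)‖ ≤ ε / 2 := by
      have h1 : ‖e x‖ ≤ |C| + 1 := (hC x).trans ((le_abs_self C).trans (by linarith))
      calc ‖A (e x)‖ ≤ ‖A‖ * ‖e x‖ := A.le_opNorm _
        _ ≤ ε / 2 / (|C| + 1) * (|C| + 1) := by gcongr
        _ = ε / 2 := div_mul_cancel₀ _ (by positivity)
    calc dist (k x + A (e x)) (f x) ≤ dist (k x + A (e x)) (k x) + dist (k x) (f x) :=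
          dist_triangle _ _ _
      _ < ε / 2 + ε / 2 := add_lt_add_of_le_of_lt (by simpa using hb) (hkf x)
      _ = ε := add_halves ε

end Embedding

theorem theorem3 {m p q : ℕ}
    {X : Type*} [TopologicalSpace X] [ChartedSpace (EuclideanSpace ℝ (Fin m)) X]
    [IsManifold (𝓡 m) ∞ X] [T2Space X] [CompactSpace X]
    {Y : Set (EuclideanSpace ℝ (Fin q))} (f : X → Y) (hf : Continuous f)
    (g : EuclideanSpace ℝ (Fin p) →ₗ[ℝ] EuclideanSpace ℝ (Fin q))
    (hg : Function.Surjective g) (hp : 2 * m < p)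
    (N : Seminorm ℝ (EuclideanSpace ℝ (Fin q))) (hN : ∀ v, N v = 0 → v = 0)
    (ε : ℝ) (hε : 0 < ε) :
    ∃ h : X → EuclideanSpace ℝ (Fin p),
      Manifold.IsSmoothEmbedding (𝓡 m) (𝓡 p) ∞ h ∧
        ∀ x : X, N ((f x : EuclideanSpace ℝ (Fin q)) - g (h x)) < ε := by
  obtain ⟨s, hs⟩ := g.exists_rightInverse_of_surjective (LinearMap.range_eq_top.2 hg)
  -- A seminorm is convex, hence continuous in finite dimension.
  have hcont : Continuous fun v ↦ N (g v) :=
    (N.convexOn.continuousOn isOpen_univ |> continuousOn_univ.1).comp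
      g.continuous_of_finiteDimensional
  obtain ⟨δ, hδ, hNδ⟩ := Metric.continuousAt_iff.1 (hcont.continuousAt (x := 0)) ε hε
  obtain ⟨h, hemb, hdist⟩ := exists_isSmoothEmbedding_dist_lt_of_continuous hp
    (s.continuous_of_finiteDimensional.comp (continuous_subtype_val.comp hf)) hδ
  refine ⟨h, hemb, fun x ↦ ?_⟩
  have hgs : g (s (f x)) = f x := LinearMap.congr_fun hs _
  have := hNδ (x := s (f x) - h x) (by
    rw [dist_zero_right, ← dist_eq_norm, dist_comm]; exact hdist x)
  simpa [hgs, abs_of_nonneg (apply_nonneg N _)] using this
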